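/- Let $(M,g)$ be a complete smooth $m$-dimensional Riemannian manifold (without boundary), let $f\in C^\infty(M)$, and consider the weighted manifold $(M,g,e^{-f}d\mathrm{vol})$ with its $f$-Laplacian $\Delta_f u=e^{f}\operatorname{div}(e^{-f}\nabla u)$. Assume that the full Omori–Yau maximum principle for $\Delta_f$ holds on $M$: for every $u\in C^2(M)$ with $u^*=\sup_M u<+\infty$ there is a sequence $(x_k)_{k\ge 1}\subset M$ such that, for every integer $k\ge 1$, $$u(x_k)>u^*-\tfrac1k,\qquad |\nabla u(x_k)|<\tfrac1k,\qquad \Delta_f u(x_k)<\tfrac1k .$$ Let $\Phi(t,y)$, $t\in\mathbb R$, $y\in[0,+\infty)$, be continuous in $t$ for each $y$, of class $C^2$ in $y$ on $[0,+\infty)$ for each $t$ (derivatives at $y=0$ being one-sided), and such that $\frac{\partial\Phi}{\partial y}(t,y)\ge 0$ for all $t\in\mathbb R$, $y\ge 0$. Set $\varphi(t)=\Phi(t,0)$. Let $v\in C^2(M)$ satisfy $$\Delta_f v\ \ge\ \Phi(v,|\nabla v|)\qquad\text{on } M .$$ Suppose that there exist $a\in\mathbb R$ and a continuous function $F$, positive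 on $[a,+\infty)$, such that $$\Big\{\int_a^tF(s)\,ds\Big\}^{-1/2}\in L^1(+\infty),\qquad \limsup_{t\to+\infty}\frac{\int_a^tF(s)\,ds}{t\,F(t)}<+\infty,$$ $$\liminf_{t\to+\infty}\frac{\varphi(t)}{F(t)}>0,\qquad \liminf_{t\to+\infty}\frac{\big\{\int_a^tF(s)\,ds\big\}^{1/2}}{F(t)}\,\frac{\partial\Phi}{\partial y}(t,0)>-\infty,$$ where $L^1(+\infty)$ means integrable on some neighbourhood of $+\infty$, and the limits superior and inferior are taken in $[-\infty,+\infty]$. Then $$v^*=\sup_M v<+\infty\qquad\text{and}\qquad \varphi(v^*)\le 0 .$$ -/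

import Mathlib

open Set Filter MeasureTheory Bundle
open scoped Manifold ContDiff Topology

noncomputable section WeightedManifold

variable {m : ℕ} {M : Type*} [TopologicalSpace M] [ChartedSpace (EuclideanSpace ℝ (Fin m)) M]

/-- The `i`-th coordinate vector field of the preferred chart at `x₀`, at the point with
coordinates `y` in that chart. -/
def coordField (x₀ : M) (i : Fin m) (y : EuclideanSpace ℝ (Fin m)) :
    TangentSpace (𝓡 m) ((extChartAt (𝓡 m) x₀).symm y) :=
  mfderiv 𝓘(ℝ, EuclideanSpace ℝ (Fin m)) (𝓡 m) (extChartAt (𝓡 m) x₀).symm y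
    (EuclideanSpace.single i (1 : ℝ))

/-- The `i`-th component of the vector field `X` in the preferred chart at `x₀`, at the point
with coordinates `y` in that chart. -/
def coordComponent (X : (x : M) → TangentSpace (𝓡 m) x) (x₀ : M) (i : Fin m)
    (y : EuclideanSpace ℝ (Fin m)) : ℝ :=
  let w : EuclideanSpace ℝ (Fin m) :=
    mfderiv (𝓡 m) 𝓘(ℝ, EuclideanSpace ℝ (Fin m)) (extChartAt (𝓡 m) x₀)
      ((extChartAt (𝓡 m) x₀).symm y) (X ((extChartAt (𝓡 m) x₀).symm y))
  w i

variable [RiemannianBundle (fun x : M => TangentSpace (𝓡 m) x)]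

/-- The matrix `g_{ij}` of the Riemannian metric in the preferred chart at `x₀`. -/
def metricMatrix (x₀ : M) (y : EuclideanSpace ℝ (Fin m)) : Matrix (Fin m) (Fin m) ℝ :=
  Matrix.of fun i j => inner ℝ (coordField x₀ i y) (coordField x₀ j y)

/-- The divergence of a vector field,
`div X = (det g)^{-1/2} ∑ i, ∂_i ((det g)^{1/2} X^i)`, in the preferred chart at the point. -/
def riemannianDiv (X : (x : M) → TangentSpace (𝓡 m) x) (x : M) : ℝ :=
  (√(metricMatrix x (extChartAt (𝓡 m) x x)).det)⁻¹ *
    ∑ i : Fin m, fderiv ℝ (fun y => √(metricMatrix x y).det * coordComponent X x i y)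
      (extChartAt (𝓡 m) x x) (EuclideanSpace.single i (1 : ℝ))

instance tangentSpace_finiteDimensional (x : M) :
    FiniteDimensional ℝ (TangentSpace (𝓡 m) x) :=
  inferInstanceAs (FiniteDimensional ℝ (EuclideanSpace ℝ (Fin m)))

/-- The Riemannian gradient: the tangent vector representing the differential of `u` at `x`. -/
def riemannianGrad (u : M → ℝ) (x : M) : TangentSpace (𝓡 m) x :=
  haveI : CompleteSpace (TangentSpace (𝓡 m) x) :=
    FiniteDimensional.complete ℝ (TangentSpace (𝓡 m) x)
  (InnerProductSpace.toDual ℝ (TangentSpace (𝓡 m) x)).symm (mfderiv (𝓡 m) 𝓘(ℝ, ℝ) u x)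

/-- The `f`-Laplacian `Δ_f u = e^f div (e^{-f} ∇u)`. -/
def fLaplacian (f u : M → ℝ) (x : M) : ℝ :=
  Real.exp (f x) * riemannianDiv (m := m) (fun p => Real.exp (-f p) • riemannianGrad u p) x

/-- The full Omori–Yau maximum principle for the `f`-Laplacian. -/
def FullOmoriYau (m : ℕ) {M : Type*} [TopologicalSpace M]
    [ChartedSpace (EuclideanSpace ℝ (Fin m)) M]
    [RiemannianBundle (fun x : M => TangentSpace (𝓡 m) x)] (f : M → ℝ) : Prop :=
  ∀ u : M → ℝ, ContMDiff (𝓡 m) 𝓘(ℝ, ℝ) 2 u → BddAbove (range u) →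
    ∃ x : ℕ → M, ∀ k : ℕ, 1 ≤ k →
      (⨆ p, u p) - 1 / (k : ℝ) < u (x k) ∧
      ‖riemannianGrad (m := m) u (x k)‖ < 1 / (k : ℝ) ∧
      fLaplacian (m := m) f u (x k) < 1 / (k : ℝ)

end WeightedManifold

/-! Since `Φ` is nondecreasing in the gradient variable, `Δ_f v ≥ φ(v)` with `φ(t) = Φ(t,0)`. Write
`P(t) = ∫_a^t F`. Suppose `v` is unbounded above. The idea is to compress `v` by a bounded
increasing `G` with `G' = P^{-1/2}` near infinity (`exists_bounded_primitive`); there `G'' = -F G'^3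
/ 2`, and `G ∘ v` is bounded, so the Omori–Yau principle applies to it. By the chain rule
`fLaplacian_comp`, `Δ_f(G ∘ v) ≥ F G' (c - |∇(G ∘ v)|² / 2)` where `v` is large and `φ ≥ c F`. At
the Omori–Yau points the gradient is small, so `c F G' / 2` is bounded by `1/k`. On the other hand
`P ≤ C t F` and `P G'^2 = 1` give `1 ≤ C (F G') (t G')`. Being decreasing and integrable at
infinity, `G'` satisfies `t G' → 0`, so `F G' → ∞`: a contradiction (`FullOmoriYau.bddAbove`). Once
`v` is bounded above, the principle applied to `v` itself gives `φ(v^*) ≤ 0`. -/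

/-! ### Linear algebra: differentiability of determinants and inverses, standard coordinates. -/

theorem Matrix.differentiableAt_det {E : Type*} [NormedAddCommGroup E] [NormedSpace ℝ E]
    {n : Type*} [Fintype n] [DecidableEq n] {A : E → Matrix n n ℝ} {y : E}
    (hA : ∀ i j, DifferentiableAt ℝ (fun y => A y i j) y) :
    DifferentiableAt ℝ (fun y => (A y).det) y := by
  simp only [Matrix.det_apply]
  refine DifferentiableAt.fun_sum fun σ _ => DifferentiableAt.const_smul ?_ _
  exact (HasFDerivAt.finsetProd fun i _ => (hA (σ i) i).hasFDerivAt).differentiableAt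

theorem Matrix.differentiableAt_inv {E : Type*} [NormedAddCommGroup E] [NormedSpace ℝ E]
    {n : Type*} [Fintype n] [DecidableEq n] {A : E → Matrix n n ℝ} {y : E}
    (hA : ∀ i j, DifferentiableAt ℝ (fun y => A y i j) y) (hdet : (A y).det ≠ 0) (i j : n) :
    DifferentiableAt ℝ (fun y => (A y)⁻¹ i j) y := by
  simp only [Matrix.inv_def, Matrix.smul_apply, Ring.inverse_eq_inv', Matrix.adjugate_apply,
    smul_eq_mul]
  refine ((Matrix.differentiableAt_det hA).inv hdet).mul (Matrix.differentiableAt_det fun k l => ?_)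
  by_cases hk : k = j
  · subst hk
    simp
  · simpa [Matrix.updateRow_ne hk] using hA k l

theorem EuclideanSpace.map_eq_sum_single {m : ℕ} {V : Type*} [AddCommGroup V] [Module ℝ V]
    (L : EuclideanSpace ℝ (Fin m) →ₗ[ℝ] V) (w : EuclideanSpace ℝ (Fin m)) :
    L w = ∑ i, w i • L (EuclideanSpace.single i (1 : ℝ)) := by
  have h : w = ∑ i, w i • EuclideanSpace.single i (1 : ℝ) := by
    ext j
    simp [Finset.sum_apply, Pi.single_apply]
  conv_lhs => rw [h]
  simp only [map_sum, map_smul]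

theorem EuclideanSpace.linearIndependent_map_single {m : ℕ} {V : Type*} [AddCommGroup V]
    [Module ℝ V] (L : EuclideanSpace ℝ (Fin m) →ₗ[ℝ] V) (hL : Function.Injective L) :
    LinearIndependent ℝ (fun i => L (EuclideanSpace.single i (1 : ℝ))) := by
  have h := (EuclideanSpace.basisFun (Fin m) ℝ).toBasis.linearIndependent.map' L
    (LinearMap.ker_eq_bot.2 hL)
  simpa only [Function.comp_def, OrthonormalBasis.coe_toBasis, EuclideanSpace.basisFun_apply]
    using h

/-! ### The gradient and its chain rule. -/

section Gradient

variable {m : ℕ} {M : Type*} [TopologicalSpace M] [ChartedSpace (EuclideanSpace ℝ (Fin m)) M]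

theorem coordComponent_smul (h : M → ℝ) (X : (x : M) → TangentSpace (𝓡 m) x) (x₀ : M)
    (i : Fin m) (y : EuclideanSpace ℝ (Fin m)) :
    coordComponent (fun p => h p • X p) x₀ i y =
      h ((extChartAt (𝓡 m) x₀).symm y) * coordComponent X x₀ i y := by
  simp only [coordComponent, map_smul]
  rfl

variable [RiemannianBundle (fun x : M => TangentSpace (𝓡 m) x)]

theorem inner_riemannianGrad (u : M → ℝ) (x : M) (w : TangentSpace (𝓡 m) x) :
    inner ℝ (riemannianGrad u x) w = mfderiv (𝓡 m) 𝓘(ℝ, ℝ) u x w := by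
  have : CompleteSpace (TangentSpace (𝓡 m) x) :=
    FiniteDimensional.complete ℝ (TangentSpace (𝓡 m) x)
  exact InnerProductSpace.toDual_symm_apply

theorem riemannianGrad_comp {u : M → ℝ} {x : M} (hu : MDifferentiableAt (𝓡 m) 𝓘(ℝ, ℝ) u x)
    {G : ℝ → ℝ} (hG : DifferentiableAt ℝ G (u x)) :
    riemannianGrad (m := m) (G ∘ u) x = deriv G (u x) • riemannianGrad u x := by
  refine ext_inner_right ℝ fun w => ?_
  rw [real_inner_smul_left, inner_riemannianGrad, inner_riemannianGrad,
    mfderiv_comp x hG.mdifferentiableAt hu, mfderiv_eq_fderiv]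
  exact (fderiv_eq_smul_deriv (f := G) (x := u x) _).trans (mul_comm _ _)

end Gradient

/-! ### Local coordinates, and the product and chain rules for `Δ_f`. -/

section Coordinates

variable {m : ℕ} {M : Type*} [TopologicalSpace M] [ChartedSpace (EuclideanSpace ℝ (Fin m)) M]
  [IsManifold (𝓡 m) ∞ M]

theorem mdifferentiableAt_chart_symm (x₀ : M) {y : EuclideanSpace ℝ (Fin m)}
    (hy : y ∈ (extChartAt (𝓡 m) x₀).target) :
    MDifferentiableAt 𝓘(ℝ, EuclideanSpace ℝ (Fin m)) (𝓡 m) (extChartAt (𝓡 m) x₀).symm y :=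
  have : IsManifold (𝓡 m) 1 M := IsManifold.of_le (n := ∞) (by norm_cast)
  ((contMDiffOn_extChartAt_symm (n := 1) x₀).contMDiffAt
    ((isOpen_extChartAt_target x₀).mem_nhds hy)).mdifferentiableAt (by norm_num)

theorem mfderiv_chart_symm_comp_mfderiv_chart (x₀ : M) {y : EuclideanSpace ℝ (Fin m)}
    (hy : y ∈ (extChartAt (𝓡 m) x₀).target)
    (w : TangentSpace (𝓡 m) ((extChartAt (𝓡 m) x₀).symm y)) :
    mfderiv 𝓘(ℝ, EuclideanSpace ℝ (Fin m)) (𝓡 m) (extChartAt (𝓡 m) x₀).symm y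
      (mfderiv (𝓡 m) 𝓘(ℝ, EuclideanSpace ℝ (Fin m)) (extChartAt (𝓡 m) x₀)
        ((extChartAt (𝓡 m) x₀).symm y) w) = w := by
  have : IsManifold (𝓡 m) 1 M := IsManifold.of_le (n := ∞) (by norm_cast)
  have h := mfderivWithin_extChartAt_symm_comp_mfderiv_extChartAt (I := 𝓡 m) (x := x₀) hy
  rw [modelWithCornersSelf_coe, range_id, mfderivWithin_univ] at h
  exact congrArg (fun L => L w) h

theorem mfderiv_chart_comp_mfderiv_chart_symm (x₀ : M) {y : EuclideanSpace ℝ (Fin m)}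
    (hy : y ∈ (extChartAt (𝓡 m) x₀).target) (w : EuclideanSpace ℝ (Fin m)) :
    mfderiv (𝓡 m) 𝓘(ℝ, EuclideanSpace ℝ (Fin m)) (extChartAt (𝓡 m) x₀)
        ((extChartAt (𝓡 m) x₀).symm y)
      (mfderiv 𝓘(ℝ, EuclideanSpace ℝ (Fin m)) (𝓡 m) (extChartAt (𝓡 m) x₀).symm y w) = w := by
  have : IsManifold (𝓡 m) 1 M := IsManifold.of_le (n := ∞) (by norm_cast)
  have h := mfderiv_extChartAt_comp_mfderivWithin_extChartAt_symm (I := 𝓡 m) (x := x₀) hy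
  rw [modelWithCornersSelf_coe, range_id, mfderivWithin_univ] at h
  exact congrArg (fun L => L w) h

theorem sum_coordComponent_smul_coordField (X : (x : M) → TangentSpace (𝓡 m) x) (x₀ : M)
    {y : EuclideanSpace ℝ (Fin m)} (hy : y ∈ (extChartAt (𝓡 m) x₀).target) :
    ∑ i, coordComponent X x₀ i y • coordField x₀ i y = X ((extChartAt (𝓡 m) x₀).symm y) :=
  (EuclideanSpace.map_eq_sum_single (V := TangentSpace (𝓡 m) ((extChartAt (𝓡 m) x₀).symm y))
    (mfderiv 𝓘(ℝ, EuclideanSpace ℝ (Fin m)) (𝓡 m) (extChartAt (𝓡 m) x₀).symm y).toLinearMap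
    _).symm.trans (mfderiv_chart_symm_comp_mfderiv_chart x₀ hy _)

theorem linearIndependent_coordField (x₀ : M) {y : EuclideanSpace ℝ (Fin m)}
    (hy : y ∈ (extChartAt (𝓡 m) x₀).target) :
    LinearIndependent ℝ (fun i => coordField (m := m) x₀ i y) := by
  refine EuclideanSpace.linearIndependent_map_single
    (V := TangentSpace (𝓡 m) ((extChartAt (𝓡 m) x₀).symm y))
    (mfderiv 𝓘(ℝ, EuclideanSpace ℝ (Fin m)) (𝓡 m) (extChartAt (𝓡 m) x₀).symm
    y).toLinearMap fun v w hvw => ?_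
  have := congrArg (mfderiv (𝓡 m) 𝓘(ℝ, EuclideanSpace ℝ (Fin m)) (extChartAt (𝓡 m) x₀)
        ((extChartAt (𝓡 m) x₀).symm y)) hvw
  exact ((mfderiv_chart_comp_mfderiv_chart_symm x₀ hy v).symm.trans this).trans
    (mfderiv_chart_comp_mfderiv_chart_symm x₀ hy w)

theorem contDiffOn_comp_chart_symm {n : WithTop ℕ∞} (hn : n ≤ ∞) {u : M → ℝ}
    (hu : ContMDiff (𝓡 m) 𝓘(ℝ, ℝ) n u) (x₀ : M) :
    ContDiffOn ℝ n (fun y => u ((extChartAt (𝓡 m) x₀).symm y)) (extChartAt (𝓡 m) x₀).target := by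
  have : IsManifold (𝓡 m) n M := IsManifold.of_le (n := ∞) hn
  rw [← contMDiffOn_iff_contDiffOn]
  exact hu.comp_contMDiffOn (contMDiffOn_extChartAt_symm x₀)

/-- The coordinate field is the tangent map of the inverse chart applied to a constant section;
passing to the tangent map costs one derivative. -/
theorem contMDiffOn_coordField (x₀ : M) (i : Fin m) :
    ContMDiffOn 𝓘(ℝ, EuclideanSpace ℝ (Fin m)) (𝓡 m).tangent 1
      (fun y => (⟨(extChartAt (𝓡 m) x₀).symm y, coordField x₀ i y⟩ : TangentBundle (𝓡 m) M))
      (extChartAt (𝓡 m) x₀).target := by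
  have : IsManifold (𝓡 m) 2 M := IsManifold.of_le (n := ∞) (by norm_cast)
  have h := (contMDiffOn_extChartAt_symm (I := 𝓡 m) (n := 2) x₀).contMDiffOn_tangentMapWithin
    (m := 1) (by norm_num) (isOpen_extChartAt_target x₀).uniqueMDiffOn
  have hs : ContMDiff 𝓘(ℝ, EuclideanSpace ℝ (Fin m))
      (𝓘(ℝ, EuclideanSpace ℝ (Fin m)).tangent) 1
      (fun y => (⟨y, EuclideanSpace.single i (1 : ℝ)⟩ :
        TangentBundle 𝓘(ℝ, EuclideanSpace ℝ (Fin m)) (EuclideanSpace ℝ (Fin m)))) := by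
    exact contMDiff_vectorSpace_iff_contDiff.2 contDiff_const
  refine (h.comp hs.contMDiffOn (fun y hy => hy)).congr fun y hy => ?_
  simp only [Function.comp, tangentMapWithin, coordField,
    mfderivWithin_of_isOpen (isOpen_extChartAt_target x₀) hy]

variable [RiemannianBundle (fun x : M => TangentSpace (𝓡 m) x)]

/-- A Gram matrix of linearly independent vectors is positive definite. -/
theorem det_metricMatrix_pos (x₀ : M) {y : EuclideanSpace ℝ (Fin m)}
    (hy : y ∈ (extChartAt (𝓡 m) x₀).target) : 0 < (metricMatrix x₀ y).det := by
  have h : metricMatrix x₀ y = Matrix.gram ℝ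
      (E := TangentSpace (𝓡 m) ((extChartAt (𝓡 m) x₀).symm y)) (fun i => coordField x₀ i y) := rfl
  rw [h]
  refine (Matrix.posDef_gram_of_linearIndependent (𝕜 := ℝ)
      (E := TangentSpace (𝓡 m) ((extChartAt (𝓡 m) x₀).symm y)) ?_).det_pos
  have h2 := linearIndependent_coordField x₀ hy
  convert! h2

theorem fderiv_comp_chart_symm {u : M → ℝ} (hu : MDifferentiable (𝓡 m) 𝓘(ℝ, ℝ) u) (x₀ : M)
    {y : EuclideanSpace ℝ (Fin m)} (hy : y ∈ (extChartAt (𝓡 m) x₀).target) (i : Fin m) :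
    fderiv ℝ (fun y => u ((extChartAt (𝓡 m) x₀).symm y)) y (EuclideanSpace.single i (1 : ℝ)) =
      inner ℝ (riemannianGrad u ((extChartAt (𝓡 m) x₀).symm y)) (coordField x₀ i y) := by
  rw [inner_riemannianGrad, ← mfderiv_eq_fderiv]
  have := mfderiv_comp y (hu _) (mdifferentiableAt_chart_symm x₀ hy)
  exact congrArg (fun L => L (EuclideanSpace.single i (1 : ℝ))) this

/-- Lowering the index of the gradient; inverting this relation gives the regularity of its
components. -/
theorem metricMatrix_mulVec_coordComponent_riemannianGrad {u : M → ℝ}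
    (hu : MDifferentiable (𝓡 m) 𝓘(ℝ, ℝ) u) (x₀ : M)
    {y : EuclideanSpace ℝ (Fin m)} (hy : y ∈ (extChartAt (𝓡 m) x₀).target) :
    (metricMatrix x₀ y).mulVec (fun i => coordComponent (riemannianGrad u) x₀ i y) =
      fun i => fderiv ℝ (fun y => u ((extChartAt (𝓡 m) x₀).symm y)) y
        (EuclideanSpace.single i (1 : ℝ)) := by
  funext j
  rw [fderiv_comp_chart_symm hu x₀ hy, ← sum_coordComponent_smul_coordField (riemannianGrad u) x₀ hy,
    sum_inner]
  simp only [Matrix.mulVec, dotProduct, metricMatrix, Matrix.of_apply, real_inner_smul_left]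
  exact Finset.sum_congr rfl fun i _ => by rw [real_inner_comm, mul_comm]

variable [IsContMDiffRiemannianBundle (𝓡 m) ∞ (EuclideanSpace ℝ (Fin m))
  (fun x : M => TangentSpace (𝓡 m) x)]

theorem differentiableAt_metricMatrix (x₀ : M) {y : EuclideanSpace ℝ (Fin m)}
    (hy : y ∈ (extChartAt (𝓡 m) x₀).target) (i j : Fin m) :
    DifferentiableAt ℝ (fun y => metricMatrix x₀ y i j) y := by
  have hT := (isOpen_extChartAt_target x₀).mem_nhds hy
  have : IsContMDiffRiemannianBundle (𝓡 m) 1 (EuclideanSpace ℝ (Fin m))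
      (fun x : M => TangentSpace (𝓡 m) x) := IsContMDiffRiemannianBundle.of_le (n := ∞) (by norm_cast)
  have h := ContMDiffAt.inner_bundle ((contMDiffOn_coordField x₀ i).contMDiffAt hT)
    ((contMDiffOn_coordField x₀ j).contMDiffAt hT)
  exact (h.mdifferentiableAt (by norm_num)).differentiableAt

theorem differentiableAt_coordComponent_riemannianGrad {u : M → ℝ}
    (hu : ContMDiff (𝓡 m) 𝓘(ℝ, ℝ) 2 u) (x₀ : M)
    {y : EuclideanSpace ℝ (Fin m)} (hy : y ∈ (extChartAt (𝓡 m) x₀).target) (i : Fin m) :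
    DifferentiableAt ℝ (coordComponent (riemannianGrad u) x₀ i) y := by
  have hT := (isOpen_extChartAt_target x₀).mem_nhds hy
  have hd : ∀ j : Fin m, DifferentiableAt ℝ (fun z => fderiv ℝ
      (fun y => u ((extChartAt (𝓡 m) x₀).symm y)) z (EuclideanSpace.single j (1 : ℝ))) y := by
    intro j
    have h := ((contDiffOn_comp_chart_symm (by norm_cast) hu x₀).contDiffAt hT).fderiv_right
      (m := 1) (by norm_num)
    exact (h.differentiableAt (by norm_num)).clm_apply (differentiableAt_const _)
  have hsum : DifferentiableAt ℝ (fun z => ∑ j, (metricMatrix x₀ z)⁻¹ i j * fderiv ℝ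
      (fun y => u ((extChartAt (𝓡 m) x₀).symm y)) z (EuclideanSpace.single j (1 : ℝ))) y :=
    DifferentiableAt.fun_sum fun j _ => (Matrix.differentiableAt_inv
      (differentiableAt_metricMatrix x₀ hy) (det_metricMatrix_pos x₀ hy).ne' i j).mul (hd j)
  -- The formula `(∇u)^i = g^{ij} ∂_j u` is available only on the chart target, which is a
  -- neighbourhood of `y`.
  refine hsum.congr_of_eventuallyEq ?_
  filter_upwards [hT] with z hz
  have h := metricMatrix_mulVec_coordComponent_riemannianGrad
    (hu.mdifferentiable (by norm_num)) x₀ hz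
  have h' := congrFun (congrArg ((metricMatrix x₀ z)⁻¹.mulVec) h) i
  rw [Matrix.mulVec_mulVec, Matrix.nonsing_inv_mul _
    (det_metricMatrix_pos x₀ hz).ne'.isUnit, Matrix.one_mulVec] at h'
  exact h'

/-- The product rule `div (h X) = h div X + dh(X)`. -/
theorem riemannianDiv_smul {X : (x : M) → TangentSpace (𝓡 m) x} {h : M → ℝ} {x : M}
    (hX : ∀ i, DifferentiableAt ℝ (coordComponent X x i) (extChartAt (𝓡 m) x x))
    (hh : ContMDiff (𝓡 m) 𝓘(ℝ, ℝ) 1 h) :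
    riemannianDiv (fun p => h p • X p) x =
      h x * riemannianDiv X x + inner ℝ (riemannianGrad h x) (X x) := by
  have hy : extChartAt (𝓡 m) x x ∈ (extChartAt (𝓡 m) x).target := mem_extChartAt_target x
  have hx : (extChartAt (𝓡 m) x).symm (extChartAt (𝓡 m) x x) = x := extChartAt_to_inv x
  have hdet := det_metricMatrix_pos x hy
  have hsq : DifferentiableAt ℝ (fun y => √(metricMatrix x y).det) (extChartAt (𝓡 m) x x) :=
    (Matrix.differentiableAt_det (differentiableAt_metricMatrix x hy)).sqrt hdet.ne'
  have hhd : DifferentiableAt ℝ (fun y => h ((extChartAt (𝓡 m) x).symm y))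
      (extChartAt (𝓡 m) x x) :=
    ((contDiffOn_comp_chart_symm (by norm_cast) hh x).contDiffAt
      ((isOpen_extChartAt_target x).mem_nhds hy)).differentiableAt (by norm_num)
  have hterm : ∀ i : Fin m,
      fderiv ℝ (fun y => √(metricMatrix x y).det * coordComponent (fun p => h p • X p) x i y)
        (extChartAt (𝓡 m) x x) (EuclideanSpace.single i (1 : ℝ)) =
      h x * fderiv ℝ (fun y => √(metricMatrix x y).det * coordComponent X x i y)
        (extChartAt (𝓡 m) x x) (EuclideanSpace.single i (1 : ℝ)) +
      √(metricMatrix x (extChartAt (𝓡 m) x x)).det *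
        (coordComponent X x i (extChartAt (𝓡 m) x x) *
          inner ℝ (riemannianGrad h ((extChartAt (𝓡 m) x).symm (extChartAt (𝓡 m) x x)))
            (coordField x i (extChartAt (𝓡 m) x x))) := by
    intro i
    rw [← fderiv_comp_chart_symm (hh.mdifferentiable (by norm_num)) x hy]
    have e : (fun y => √(metricMatrix x y).det * coordComponent (fun p => h p • X p) x i y) =
        fun y => h ((extChartAt (𝓡 m) x).symm y) *
          (√(metricMatrix x y).det * coordComponent X x i y) := by
      funext y
      rw [coordComponent_smul]
      ring
    rw [e, fderiv_fun_mul hhd (hsq.fun_mul (hX i))]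
    simp only [add_apply, smul_apply, smul_eq_mul, hx]
    ring
  have hinner : ∑ i, coordComponent X x i (extChartAt (𝓡 m) x x) *
      inner ℝ (riemannianGrad h ((extChartAt (𝓡 m) x).symm (extChartAt (𝓡 m) x x)))
        (coordField x i (extChartAt (𝓡 m) x x)) = inner ℝ (riemannianGrad h x) (X x) := by
    have h1 := congrArg (fun w => inner ℝ
      (riemannianGrad h ((extChartAt (𝓡 m) x).symm (extChartAt (𝓡 m) x x))) w)
      (sum_coordComponent_smul_coordField X x hy)
    simp only [inner_sum, real_inner_smul_right] at h1
    exact h1.trans (congrArg (fun p => inner ℝ (riemannianGrad h p) (X p)) hx)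
  have hs : √(metricMatrix x (extChartAt (𝓡 m) x x)).det ≠ 0 := (Real.sqrt_pos.2 hdet).ne'
  simp only [riemannianDiv]
  rw [Finset.sum_congr rfl fun i _ => hterm i, Finset.sum_add_distrib, ← Finset.mul_sum,
    ← Finset.mul_sum, hinner]
  field_simp

/-- The chain rule `Δ_f (G ∘ u) = G'(u) Δ_f u + G''(u) |∇u|²`. -/
theorem fLaplacian_comp {f : M → ℝ} (hf : ContMDiff (𝓡 m) 𝓘(ℝ, ℝ) 1 f) {u : M → ℝ}
    (hu : ContMDiff (𝓡 m) 𝓘(ℝ, ℝ) 2 u) {G : ℝ → ℝ} (hG : ContDiff ℝ 2 G) (x : M) :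
    fLaplacian (m := m) f (G ∘ u) x = deriv G (u x) * fLaplacian (m := m) f u x +
      deriv (deriv G) (u x) * ‖riemannianGrad (m := m) u x‖ ^ 2 := by
  have hG' : ContDiff ℝ 1 (deriv G) := hG.deriv' (n := 1)
  have hum := hu.mdifferentiable (by norm_num)
  have hy : extChartAt (𝓡 m) x x ∈ (extChartAt (𝓡 m) x).target := mem_extChartAt_target x
  -- The weighted gradient of `G ∘ u` is the function `G'(u)` times that of `u`, so the product rule
  -- for the divergence produces both terms.
  have hfield : (fun p => Real.exp (-f p) • riemannianGrad (m := m) (G ∘ u) p) =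
      fun p => (deriv G ∘ u) p • (Real.exp (-f p) • riemannianGrad (m := m) u p) := by
    funext p
    rw [riemannianGrad_comp (hum p) (hG.differentiable (by norm_num)).differentiableAt, smul_comm]
    rfl
  have hX : ∀ i, DifferentiableAt ℝ
      (coordComponent (fun p => Real.exp (-f p) • riemannianGrad (m := m) u p) x i)
      (extChartAt (𝓡 m) x x) := by
    intro i
    have e : coordComponent (fun p => Real.exp (-f p) • riemannianGrad (m := m) u p) x i =
        fun y => Real.exp (-f ((extChartAt (𝓡 m) x).symm y)) *
          coordComponent (riemannianGrad u) x i y :=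
      funext fun y => coordComponent_smul (fun p => Real.exp (-f p)) _ x i y
    rw [e]
    refine DifferentiableAt.mul (DifferentiableAt.exp (DifferentiableAt.neg ?_))
      (differentiableAt_coordComponent_riemannianGrad hu x hy i)
    exact ((contDiffOn_comp_chart_symm (by norm_cast) hf x).contDiffAt
      ((isOpen_extChartAt_target x).mem_nhds hy)).differentiableAt (by norm_num)
  have hh : ContMDiff (𝓡 m) 𝓘(ℝ, ℝ) 1 (deriv G ∘ u) :=
    hG'.contMDiff.comp (hu.of_le (by norm_num))
  simp only [fLaplacian]
  rw [hfield, riemannianDiv_smul hX hh, riemannianGrad_comp (hum x)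
    (hG'.differentiable (by norm_num)).differentiableAt, real_inner_smul_left,
    real_inner_smul_right, real_inner_self_eq_norm_sq, Real.exp_neg]
  have := Real.exp_ne_zero (f x)
  simp only [Function.comp]
  field_simp

end Coordinates

/-! ### One-variable calculus: the bounded compressing function. -/

section Calculus

theorem intervalIntegrable_of_continuousOn_Ici {F : ℝ → ℝ} {a t : ℝ}
    (hF : ContinuousOn F (Ici a)) (ht : a ≤ t) : IntervalIntegrable F volume a t :=
  (hF.mono (by rw [uIcc_of_le ht]; exact Icc_subset_Ici_self)).intervalIntegrable

theorem hasDerivAt_integral_of_continuousOn_Ici {F : ℝ → ℝ} {a t : ℝ}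
    (hF : ContinuousOn F (Ici a)) (ht : a < t) :
    HasDerivAt (fun t => ∫ s in a..t, F s) (F t) t :=
  intervalIntegral.integral_hasDerivAt_right
    (intervalIntegrable_of_continuousOn_Ici hF ht.le)
    ((hF.mono Ioi_subset_Ici_self).stronglyMeasurableAtFilter isOpen_Ioi t ht)
    (hF.continuousAt (Ici_mem_nhds ht))

theorem integral_pos_of_continuousOn_Ici {F : ℝ → ℝ} {a t : ℝ}
    (hF : ContinuousOn F (Ici a)) (hpos : ∀ s ∈ Ici a, 0 < F s) (ht : a < t) :
    0 < ∫ s in a..t, F s :=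
  intervalIntegral.intervalIntegral_pos_of_pos_on
    (intervalIntegrable_of_continuousOn_Ici hF ht.le) (fun s hs => hpos s hs.1.le) ht

theorem rpow_neg_half_pow_three {p : ℝ} (hp : 0 < p) :
    p ^ (-(1 / 2) - 1 : ℝ) = (p ^ (-(1 / 2) : ℝ)) ^ 3 := by
  rw [← Real.rpow_natCast, ← Real.rpow_mul hp.le]
  norm_num

theorem mul_rpow_neg_half_sq {p : ℝ} (hp : 0 < p) : p * (p ^ (-(1 / 2) : ℝ)) ^ 2 = 1 := by
  rw [← Real.rpow_natCast, ← Real.rpow_mul hp.le]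
  norm_num
  rw [Real.rpow_neg_one, mul_inv_cancel₀ hp.ne']

/-- A nonnegative decreasing function integrable at infinity is `o(1/t)`. -/
theorem eventually_mul_le_of_antitoneOn_of_integrableOn {p : ℝ → ℝ} {b : ℝ}
    (hp : AntitoneOn p (Ioi b)) (hint : IntegrableOn p (Ioi b)) {ε : ℝ} (hε : 0 < ε) :
    ∀ᶠ t in atTop, t * p t ≤ ε := by
  have hlim : Tendsto (fun t => ∫ s in (b + 1)..t, p s) atTop
      (𝓝 (∫ s in Ioi (b + 1), p s)) :=
    intervalIntegral_tendsto_integral_Ioi _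
      (hint.mono_set (Ioi_subset_Ioi (by linarith))) tendsto_id
  have hhalf : Tendsto (fun t : ℝ => t / 2) atTop atTop :=
    tendsto_id.atTop_div_const (by norm_num)
  have hdiff := hlim.sub (hlim.comp hhalf)
  rw [sub_self] at hdiff
  filter_upwards [hdiff.eventually_lt_const (half_pos hε),
    hhalf.eventually_gt_atTop (b + 1), eventually_gt_atTop 0] with t ht hb h0
  have hii : ∀ r s : ℝ, b < r → b < s → IntervalIntegrable p volume r s := fun r s hr hs =>
    ⟨hint.mono_set fun x hx => hr.trans hx.1, hint.mono_set fun x hx => hs.trans hx.1⟩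
  have hsplit : (∫ s in (b + 1)..t, p s) - ∫ s in (b + 1)..(t / 2), p s =
      ∫ s in (t / 2)..t, p s :=
    intervalIntegral.integral_interval_sub_left (hii _ _ (by linarith) (by linarith))
      (hii _ _ (by linarith) (by linarith))
  -- On `[t/2, t]` the function is at least `p t`, so `t * p t / 2` is at most a Cauchy difference
  -- of the convergent integral.
  have hle : ∫ _s in (t / 2)..t, p t ≤ ∫ s in (t / 2)..t, p s :=
    intervalIntegral.integral_mono_on (by linarith) (by simp)
      (hii _ _ (by linarith) (by linarith)) fun s hs =>
        hp (mem_Ioi.2 (by linarith [hs.1])) (mem_Ioi.2 (by linarith)) hs.2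
  simp only [Function.comp, hsplit] at ht
  rw [intervalIntegral.integral_const, smul_eq_mul] at hle
  linarith

/-- A function with prescribed continuous second derivative. -/
theorem exists_contDiff_two_of_continuous {k : ℝ → ℝ} (hk : Continuous k) (b c : ℝ) :
    ∃ G : ℝ → ℝ, ContDiff ℝ 2 G ∧ G b = 0 ∧ deriv G = (fun t => c + ∫ s in b..t, k s) ∧
      deriv (deriv G) = k := by
  have hg : ∀ t, HasDerivAt (fun t => c + ∫ s in b..t, k s) (k t) t := fun t =>
    (intervalIntegral.integral_hasDerivAt_right (hk.intervalIntegrable _ _)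
      (hk.stronglyMeasurableAtFilter _ _) hk.continuousAt).const_add c
  have hgc : Continuous (fun t => c + ∫ s in b..t, k s) :=
    continuous_iff_continuousAt.2 fun t => (hg t).continuousAt
  have hG : ∀ t, HasDerivAt (fun t => ∫ r in b..t, (c + ∫ s in b..r, k s))
      (c + ∫ s in b..t, k s) t := fun t =>
    intervalIntegral.integral_hasDerivAt_right (hgc.intervalIntegrable _ _)
      (hgc.stronglyMeasurableAtFilter _ _) hgc.continuousAt
  have hG1 : deriv (fun t => ∫ r in b..t, (c + ∫ s in b..r, k s)) =
      fun t => c + ∫ s in b..t, k s := funext fun t => (hG t).deriv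
  have hg1 : deriv (fun t => c + ∫ s in b..t, k s) = k := funext fun t => (hg t).deriv
  refine ⟨fun t => ∫ r in b..t, (c + ∫ s in b..r, k s), ?_, by simp, hG1, by rw [hG1, hg1]⟩
  rw [show (2 : WithTop ℕ∞) = 1 + 1 by norm_num, contDiff_succ_iff_deriv]
  refine ⟨fun t => (hG t).differentiableAt, by norm_num, ?_⟩
  rw [hG1, contDiff_one_iff_deriv]
  exact ⟨fun t => (hg t).differentiableAt, by rwa [hg1]⟩

/-- A bounded increasing function equal to a primitive of `{∫_a^t F}^{-1/2}` near infinity. -/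
theorem exists_bounded_primitive {F : ℝ → ℝ} {a : ℝ} (hF : ContinuousOn F (Ici a))
    (hpos : ∀ t ∈ Ici a, 0 < F t)
    (hint : IntegrableAtFilter (fun t => (∫ s in a..t, F s) ^ (-(1 / 2) : ℝ)) atTop volume) :
    ∃ (G : ℝ → ℝ) (b : ℝ), a < b ∧ ContDiff ℝ 2 G ∧ BddAbove (range G) ∧ (∀ t, 0 < deriv G t) ∧
      (∀ t, b ≤ t → deriv G t = (∫ s in a..t, F s) ^ (-(1 / 2) : ℝ)) ∧
      (∀ t, b ≤ t → deriv (deriv G) t = -(1 / 2) * F t * deriv G t ^ 3) ∧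
      ∀ ε, 0 < ε → ∀ᶠ t in atTop, t * deriv G t ≤ ε := by
  set P : ℝ → ℝ := fun t => ∫ s in a..t, F s with hP
  set p : ℝ → ℝ := fun t => P t ^ (-(1 / 2) : ℝ) with hp
  have hPpos : ∀ t, a < t → 0 < P t := fun t ht => integral_pos_of_continuousOn_Ici hF hpos ht
  have hppos : ∀ t, a < t → 0 < p t := fun t ht => Real.rpow_pos_of_pos (hPpos t ht) _
  have hpd : ∀ t, a < t → HasDerivAt p (-(1 / 2) * F t * p t ^ 3) t := by
    intro t ht
    have h := (hasDerivAt_integral_of_continuousOn_Ici hF ht).rpow_const (p := -(1 / 2))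
      (Or.inl (hPpos t ht).ne')
    rw [rpow_neg_half_pow_three (hPpos t ht)] at h
    convert h using 1
    ring
  obtain ⟨S, hS, hSint⟩ := hint
  obtain ⟨b₀, hb₀⟩ := mem_atTop_sets.1 hS
  -- The integral of `F` vanishes at `a`, where its negative power is singular; `a + 1` keeps away
  -- from there, and `b₀` ensures integrability beyond `b`.
  set b := max (a + 1) b₀ with hb
  have hab : a < b := (lt_add_one a).trans_le (le_max_left _ _)
  have hpint : IntegrableOn p (Ioi b) :=
    hSint.mono_set fun t ht => hb₀ t ((le_max_right _ _).trans (le_of_lt ht))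
  -- The derivative of `p`, frozen at its value at `b` to the left of `b`. It is continuous on all
  -- of `ℝ` and nonpositive, so the primitive with value `p b` at `b` stays positive on the left.
  set k : ℝ → ℝ := fun t => -(1 / 2) * F (max t b) * p (max t b) ^ 3 with hk
  have hmax : ∀ t, a < max t b := fun t => hab.trans_le (le_max_right _ _)
  have hkc : Continuous k := by
    have h1 : Continuous fun t => F (max t b) := hF.comp_continuous
      (continuous_id.max continuous_const) fun t => (hmax t).le
    have h2 : Continuous fun t => p (max t b) := continuous_iff_continuousAt.2 fun t =>
      ContinuousAt.comp (f := fun t => max t b) (g := p) (hpd _ (hmax t)).continuousAt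
        (continuous_id.max continuous_const).continuousAt
    exact (continuous_const.mul h1).mul (h2.pow 3)
  have hk0 : ∀ t, k t ≤ 0 := fun t => by
    have := mul_pos (hpos _ (hmax t).le) (pow_pos (hppos _ (hmax t)) 3)
    simp only [hk]
    nlinarith
  obtain ⟨G, hGc, hGb, hG1, hG2⟩ := exists_contDiff_two_of_continuous hkc b (p b)
  have hge : ∀ t, b ≤ t → deriv G t = p t := by
    intro t ht
    have h : ∫ s in b..t, k s = p t - p b := by
      refine intervalIntegral.integral_eq_sub_of_hasDerivAt (fun s hs => ?_)
        (hkc.intervalIntegrable _ _)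
      rw [uIcc_of_le ht] at hs
      simp only [hk, max_eq_left hs.1]
      exact hpd s (hab.trans_le hs.1)
    rw [hG1]
    simp only [h]
    ring
  have hGpos : ∀ t, 0 < deriv G t := by
    intro t
    rcases le_total b t with ht | ht
    · rw [hge t ht]
      exact hppos t (hab.trans_le ht)
    · rw [hG1]
      have h : 0 ≤ ∫ s in t..b, -k s :=
        intervalIntegral.integral_nonneg ht fun s _ => neg_nonneg.2 (hk0 s)
      rw [intervalIntegral.integral_neg] at h
      simp only
      rw [intervalIntegral.integral_symm]
      linarith [hppos b hab]
  have hmono : StrictMono G := strictMono_of_deriv_pos hGpos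
  have hpanti : AntitoneOn p (Ioi b) := by
    intro s hs t ht hst
    exact Real.rpow_le_rpow_of_nonpos (hPpos s (hab.trans hs))
      (intervalIntegral.integral_mono_interval le_rfl (hab.trans hs).le hst
        (ae_restrict_of_forall_mem measurableSet_Ioc fun x hx => (hpos x hx.1.le).le)
        (intervalIntegrable_of_continuousOn_Ici hF (hab.trans ht).le)) (by norm_num)
  refine ⟨G, b, hab, hGc, ⟨∫ s in Ioi b, p s, ?_⟩, hGpos, hge, ?_, ?_⟩
  · rintro _ ⟨t, rfl⟩
    have hpn : 0 ≤ᵐ[volume.restrict (Ioi b)] p :=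
      ae_restrict_of_forall_mem measurableSet_Ioi fun x hx => (hppos x (hab.trans hx)).le
    rcases le_total b t with ht | ht
    · have h : ∫ s in b..t, p s = G t - G b := by
        refine intervalIntegral.integral_eq_sub_of_hasDerivAt (fun s hs => ?_)
          ⟨hpint.mono_set fun x hx => hx.1, hpint.mono_set fun x hx => ht.trans_lt hx.1⟩
        rw [uIcc_of_le ht] at hs
        rw [← hge s hs.1]
        exact (hGc.differentiable (by norm_num) s).hasDerivAt
      rw [hGb, sub_zero, intervalIntegral.integral_of_le ht] at h
      rw [← h]
      exact setIntegral_mono_set hpint hpn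
        (Eventually.of_forall fun x hx => hx.1)
    · calc G t ≤ G b := hmono.monotone ht
        _ = 0 := hGb
        _ ≤ _ := integral_nonneg_of_ae hpn
  · intro t ht
    rw [hG2, hge t ht]
    simp only [hk, max_eq_left ht]
  · intro ε hε
    filter_upwards [eventually_mul_le_of_antitoneOn_of_integrableOn hpanti hpint hε,
      eventually_ge_atTop b] with t ht htb
    rwa [hge t htb]

theorem le_of_derivWithin_Ici_nonneg {h : ℝ → ℝ} (hd : DifferentiableOn ℝ h (Ici 0))
    (h0 : ∀ y, 0 ≤ y → 0 ≤ derivWithin h (Ici 0) y) {y : ℝ} (hy : 0 ≤ y) : h 0 ≤ h y := by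
  refine monotoneOn_of_deriv_nonneg (convex_Ici 0) hd.continuousOn
    (hd.mono interior_subset) (fun x hx => ?_) self_mem_Ici hy hy
  rw [interior_Ici] at hx
  rw [← derivWithin_of_mem_nhds (Ici_mem_nhds hx)]
  exact h0 x (le_of_lt hx)

end Calculus

/-! ### Consequences of the Omori–Yau principle. -/

section OmoriYau

variable {m : ℕ} {M : Type*} [TopologicalSpace M] [ChartedSpace (EuclideanSpace ℝ (Fin m)) M]
  [RiemannianBundle (fun x : M => TangentSpace (𝓡 m) x)]

theorem exists_pos_eventually_le_mul {p : ℝ → ℝ} {F : ℝ → ℝ} (hF : ∀ᶠ t in atTop, 0 < F t)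
    (hsup : limsup (fun t => ((p t / (t * F t) : ℝ) : EReal)) atTop < ⊤) :
    ∃ C > 0, ∀ᶠ t in atTop, p t ≤ C * (t * F t) := by
  obtain ⟨C, hC, -⟩ := EReal.lt_iff_exists_real_btwn.1 hsup
  refine ⟨max C 1, by positivity, ?_⟩
  filter_upwards [eventually_lt_of_limsup_lt hC, hF, eventually_gt_atTop 0] with t ht hFt h0
  have h := (div_lt_iff₀ (mul_pos h0 hFt)).1 (EReal.coe_lt_coe_iff.1 ht)
  exact h.le.trans (mul_le_mul_of_nonneg_right (le_max_left _ _) (mul_pos h0 hFt).le)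

theorem exists_pos_eventually_mul_le {φ : ℝ → ℝ} {F : ℝ → ℝ} (hF : ∀ᶠ t in atTop, 0 < F t)
    (hinf : 0 < liminf (fun t => ((φ t / F t : ℝ) : EReal)) atTop) :
    ∃ c > 0, ∀ᶠ t in atTop, c * F t ≤ φ t := by
  obtain ⟨c, hc0, hc⟩ := EReal.lt_iff_exists_real_btwn.1 hinf
  refine ⟨c, EReal.coe_pos.1 hc0, ?_⟩
  filter_upwards [eventually_lt_of_lt_liminf hc, hF] with t ht hFt
  exact ((lt_div_iff₀ hFt).1 (EReal.coe_lt_coe_iff.1 ht)).le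

/-- Along an Omori–Yau sequence `v (x k)` tends to the supremum while `φ (v (x k)) < 1 / k`;
continuity of `φ` passes to the limit. -/
theorem FullOmoriYau.nonpos_of_bddAbove {f : M → ℝ} (hOY : FullOmoriYau m f) {φ : ℝ → ℝ}
    (hφ : Continuous φ) {v : M → ℝ} (hv : ContMDiff (𝓡 m) 𝓘(ℝ, ℝ) 2 v)
    (hineq : ∀ x, φ (v x) ≤ fLaplacian (m := m) f v x) (hb : BddAbove (range v)) :
    φ (⨆ x, v x) ≤ 0 := by
  obtain ⟨x, hx⟩ := hOY v hv hb
  have hk : Tendsto (fun k : ℕ => 1 / (k : ℝ)) atTop (𝓝 0) := tendsto_one_div_atTop_nhds_zero_nat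
  have hlim : Tendsto (fun k => v (x k)) atTop (𝓝 (⨆ p, v p)) := by
    refine tendsto_of_tendsto_of_tendsto_of_le_of_le' (g := fun k : ℕ => (⨆ p, v p) - 1 / (k : ℝ))
      (by simpa using hk.const_sub (⨆ p, v p)) tendsto_const_nhds ?_ ?_
    · filter_upwards [eventually_ge_atTop 1] with k hk1 using (hx k hk1).1.le
    · exact Eventually.of_forall fun k => le_ciSup hb (x k)
  refine le_of_tendsto_of_tendsto ((hφ.tendsto _).comp hlim) hk ?_
  filter_upwards [eventually_ge_atTop 1] with k hk1
  exact (hineq _).trans (hx k hk1).2.2.le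

variable [IsManifold (𝓡 m) ∞ M]
  [IsContMDiffRiemannianBundle (𝓡 m) ∞ (EuclideanSpace ℝ (Fin m))
    (fun x : M => TangentSpace (𝓡 m) x)]

theorem FullOmoriYau.bddAbove {f : M → ℝ} (hOY : FullOmoriYau m f)
    (hf : ContMDiff (𝓡 m) 𝓘(ℝ, ℝ) 1 f) {φ : ℝ → ℝ} {v : M → ℝ}
    (hv : ContMDiff (𝓡 m) 𝓘(ℝ, ℝ) 2 v) (hineq : ∀ x, φ (v x) ≤ fLaplacian (m := m) f v x)
    {F : ℝ → ℝ} {a : ℝ} (hF : ContinuousOn F (Ici a)) (hpos : ∀ t ∈ Ici a, 0 < F t)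
    (hint : IntegrableAtFilter (fun t => (∫ s in a..t, F s) ^ (-(1 / 2) : ℝ)) atTop volume)
    (hsup : limsup (fun t => (((∫ s in a..t, F s) / (t * F t) : ℝ) : EReal)) atTop < ⊤)
    (hinf : 0 < liminf (fun t => ((φ t / F t : ℝ) : EReal)) atTop) :
    BddAbove (range v) := by
  by_contra hunb
  have hFev : ∀ᶠ t in atTop, 0 < F t := (eventually_ge_atTop a).mono hpos
  obtain ⟨C, hC, hCev⟩ := exists_pos_eventually_le_mul hFev hsup
  obtain ⟨c, hc, hcev⟩ := exists_pos_eventually_mul_le hFev hinf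
  obtain ⟨G, b, hab, hGc, hGbdd, hGpos, hG1, hG2, hGo⟩ := exists_bounded_primitive hF hpos hint
  have hmono : StrictMono G := strictMono_of_deriv_pos hGpos
  -- The threshold `c / (2 * C)` for `t * G'` is what turns `1 ≤ C (F G') (t G')` into `F G' ≥ 2 /
  -- c`.
  obtain ⟨T, hT⟩ := eventually_atTop.1 (hCev.and (hcev.and ((hGo (c / (2 * C)) (by positivity)).and
    ((eventually_ge_atTop b).and (eventually_gt_atTop 0)))))
  have hub : BddAbove (range (G ∘ v)) := hGbdd.mono (range_comp_subset_range v G)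
  obtain ⟨x, hx⟩ := hOY (G ∘ v) (hGc.contMDiff.comp hv) hub
  -- Here unboundedness of `v` enters: it pushes the supremum of `G ∘ v` strictly above `G T`, so
  -- near-maximal points have `v > T`.
  have hTlt : G T < ⨆ p, (G ∘ v) p := by
    obtain ⟨_, ⟨p, rfl⟩, hp⟩ := not_bddAbove_iff.1 hunb T
    exact (hmono hp).trans_le (le_ciSup hub p)
  have hk : Tendsto (fun k : ℕ => 1 / (k : ℝ)) atTop (𝓝 0) := tendsto_one_div_atTop_nhds_zero_nat
  obtain ⟨k, hk1, hkT, hkc, hk1'⟩ := ((eventually_ge_atTop 1).and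
    ((hk.eventually_lt_const (sub_pos.2 hTlt)).and ((hk.eventually_lt_const hc).and
      (hk.eventually_lt_const one_pos)))).exists
  obtain ⟨hxG, hxg, hxL⟩ := hx k hk1
  set e : ℝ := 1 / (k : ℝ) with he
  have hvT : T < v (x k) := hmono.lt_iff_lt.1 (by
    simp only [Function.comp] at hxG hkT ⊢
    linarith)
  obtain ⟨h1, h2, h3, h4, h5⟩ := hT _ hvT.le
  have hvm := hv.mdifferentiable (by norm_num) (x k)
  rw [riemannianGrad_comp hvm (hGc.differentiable (by norm_num)).differentiableAt, norm_smul,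
    Real.norm_of_nonneg (hGpos _).le] at hxg
  rw [fLaplacian_comp hf hv hGc, hG2 _ h4] at hxL
  have hPq := mul_rpow_neg_half_sq
    (integral_pos_of_continuousOn_Ici hF hpos (hab.trans_le h4))
  rw [← hG1 _ h4] at hPq
  have hL := hineq (x k)
  have hFp : 0 < F (v (x k)) := hpos _ (hab.le.trans h4)
  have hq := hGpos (v (x k))
  have hn0 := norm_nonneg (riemannianGrad (m := m) v (x k))
  generalize (∫ s in a..v (x k), F s) = P at *
  generalize deriv G (v (x k)) = q at *
  generalize F (v (x k)) = A at *
  generalize ‖riemannianGrad (m := m) v (x k)‖ = n at *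
  generalize fLaplacian (m := m) f v (x k) = L at *
  generalize v (x k) = t at *
  have hqA : 2 / c ≤ A * q := by
    rw [div_le_iff₀ hc]
    have h6 : 1 ≤ C * (t * A) * q ^ 2 := by
      rw [← hPq]
      exact mul_le_mul_of_nonneg_right h1 (by positivity)
    have h7 : C * (t * A) * q ^ 2 ≤ C * (A * q) * (c / (2 * C)) := by
      calc C * (t * A) * q ^ 2 = C * (A * q) * (t * q) := by ring
        _ ≤ _ := mul_le_mul_of_nonneg_left h3 (by positivity)
    have h8 : C * (A * q) * (c / (2 * C)) = A * q * c / 2 := by field_simp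
    linarith
  have he0 : 0 ≤ e := by positivity
  -- From `q * n < e` with `e < 1` and `e < c`: `e ^ 2 ≤ e < c`.
  have hn : (q * n) ^ 2 ≤ c := by
    have hqn : 0 ≤ q * n := mul_nonneg hq.le hn0
    nlinarith
  have h9 : 2 ≤ A * q * c := (div_le_iff₀ hc).1 hqA
  have h10 : q * (c * A) ≤ q * L := mul_le_mul_of_nonneg_left (h2.trans hL) hq.le
  have h11 : A * q * (q * n) ^ 2 ≤ A * q * c := mul_le_mul_of_nonneg_left hn (by positivity)
  have h12 : -(1 / 2) * A * q ^ 3 * n ^ 2 = -(1 / 2) * (A * q * (q * n) ^ 2) := by ring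
  rw [h12] at hxL
  -- The lower bound is `c A q - c A q / 2 ≥ 1`, whereas the Omori–Yau bound is `e < 1`.
  linarith

end OmoriYau

/-! ### The main theorem. -/

theorem theorem3p1 (m : ℕ) {M : Type*} [EMetricSpace M]
    [ChartedSpace (EuclideanSpace ℝ (Fin m)) M] [IsManifold (𝓡 m) ∞ M]
    [RiemannianBundle (fun x : M => TangentSpace (𝓡 m) x)]
    [IsContMDiffRiemannianBundle (𝓡 m) ∞ (EuclideanSpace ℝ (Fin m))
      (fun x : M => TangentSpace (𝓡 m) x)]
    [IsRiemannianManifold (𝓡 m) M] [CompleteSpace M]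
    (f : M → ℝ) (hf : ContMDiff (𝓡 m) 𝓘(ℝ, ℝ) ∞ f)
    (hOY : FullOmoriYau m f)
    (Φ : ℝ → ℝ → ℝ)
    (hΦt : ∀ y : ℝ, 0 ≤ y → Continuous (fun t => Φ t y))
    (hΦy : ∀ t : ℝ, ContDiffOn ℝ 2 (Φ t) (Ici 0))
    (hΦmono : ∀ t y : ℝ, 0 ≤ y → 0 ≤ derivWithin (Φ t) (Ici 0) y)
    (v : M → ℝ) (hv : ContMDiff (𝓡 m) 𝓘(ℝ, ℝ) 2 v)
    (hineq : ∀ x : M, Φ (v x) ‖riemannianGrad (m := m) v x‖ ≤ fLaplacian (m := m) f v x)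
    (hF : ∃ (F : ℝ → ℝ) (a : ℝ), ContinuousOn F (Ici a) ∧ (∀ t ∈ Ici a, 0 < F t) ∧
      IntegrableAtFilter (fun t => (∫ s in a..t, F s) ^ (-(1 / 2) : ℝ)) atTop volume ∧
      limsup (fun t => (((∫ s in a..t, F s) / (t * F t) : ℝ) : EReal)) atTop < ⊤ ∧
      0 < liminf (fun t => ((Φ t 0 / F t : ℝ) : EReal)) atTop ∧
      ⊥ < liminf (fun t => (((∫ s in a..t, F s) ^ (1 / 2 : ℝ) / F t *
        derivWithin (Φ t) (Ici 0) 0 : ℝ) : EReal)) atTop) :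
    BddAbove (range v) ∧ Φ (⨆ x, v x) 0 ≤ 0 := by
  -- Monotonicity in `y` replaces `|∇v|` by `0`, removing the gradient from the inequality.
  have hineq' : ∀ x, Φ (v x) 0 ≤ fLaplacian (m := m) f v x := fun x =>
    (le_of_derivWithin_Ici_nonneg ((hΦy (v x)).differentiableOn (by norm_num)) (hΦmono (v x))
      (norm_nonneg (riemannianGrad (m := m) v x))).trans (hineq x)
  obtain ⟨F, a, hFc, hFpos, hint, hsup, hinf, -⟩ := hF
  have hb : BddAbove (range v) := hOY.bddAbove (φ := fun t => Φ t 0) (hf.of_le (by norm_cast)) hv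
    hineq' hFc hFpos hint hsup hinf
  exact ⟨hb, hOY.nonpos_of_bddAbove (hΦt 0 le_rfl) hv hineq' hb⟩
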